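/- Let $G$ be a finite cyclic group of odd order $|G|\ge 3$ (for instance of odd prime order), let $x$ be a generator of $G$, and let $y,g_0\in G$ be arbitrary. In the idealized Pollard Rho model each $g\in G$ is assigned, independently of the others and uniformly at random, to one of three classes $S_1,S_2,S_3$; put $F(g)=gx$ if $g\in S_1$, $F(g)=g^2$ if $g\in S_2$, $F(g)=gy$ if $g\in S_3$, and consider the walk $g_{i+1}=F(g_i)$ started at $g_0$. A collision within $n$ steps means that $g_i=g_j$ for some $0\le i<j\le n$. Consider also the Markov chain on $G$ that moves from $g$ to $gx$, $gy$ or $g^2$ according to an independent uniform choice among the three moves at each time, and the associated block walk, the Markov chain on $G$ with transition matrix $\mathsf B$, one step of which consists of running this chain up to and including its first squaring move. Let $$\tau=\tau_s^b(1/2)=\min\bigl\{n\ge 0:\ 1-|G|\,\mathsf B^n(g,h)\le \tfrac12\ \text{ for all } g,h\in G\bigr\}.$$ Then there is an absolute constant $C>0$ such that the following hold for all such $G,x,y,g_0$ and all real $c>0$. 1. $\tau$ is finite, and with $t=4\bigl(1+\tau+2\sqrt{2c\,|G|\,\tau}\bigr)$ a collision occurs within $\lfloor t\rfloor$ steps with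 probability at least $1-e^{-c}-\frac{32}{t}$. 2. For every integer $n\ge C\sqrt{(1+c)\,|G|\,\log|G|\,\log\log|G|}$, a collision occurs within $n$ steps with probability at least $1-e^{-c}-\frac{32}{n}$. In particular, for every $\varepsilon>0$ a collision occurs within $O_\varepsilon\bigl(\sqrt{|G|\log|G|\log\log|G|}\bigr)$ steps with probability at least $1-\varepsilon$. -/

import Mathlib

open MeasureTheory

universe u

namespace PollardRho

/-- The iterating function `F` determined by a partition of `G` into three classes
(`S g` is the class of `g`): multiply by `x`, square, or multiply by `y`. -/
def step {G : Type u} [Group G] (x y : G) (S : G → Fin 3) (g : G) : G :=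
  match S g with
  | 0 => g * x
  | 1 => g ^ 2
  | 2 => g * y

/-- The state `g_n` of the walk `g_{i+1} = F(g_i)` started at `g₀`. -/
def walk {G : Type u} [Group G] (x y : G) (S : G → Fin 3) (g₀ : G) (n : ℕ) : G :=
  (step x y S)^[n] g₀

/-- The walk passes over the same group element twice during its first `n` steps. -/
def CollisionWithin {G : Type u} [Group G] (x y : G) (S : G → Fin 3) (g₀ : G) (n : ℕ) : Prop :=
  ∃ i j : ℕ, i < j ∧ j ≤ n ∧ walk x y S g₀ i = walk x y S g₀ j

/-- The idealized model: every `g : G` is assigned, independently of the others, to one of the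
three classes uniformly at random. -/
noncomputable def partitionLaw (G : Type u) [Fintype G] : Measure (G → Fin 3) :=
  Measure.pi fun _ => (PMF.uniformOfFintype (Fin 3)).toMeasure

instance (G : Type u) [Fintype G] : IsProbabilityMeasure (partitionLaw G) := by
  unfold partitionLaw
  infer_instance

/-- The probability, over the random partition, of a collision within `n` steps. -/
noncomputable def collisionProb {G : Type u} [Group G] [Fintype G] (x y g₀ : G) (n : ℕ) : ℝ :=
  (partitionLaw G).real {S | CollisionWithin x y S g₀ n}

/-- The times at which the separation distance of the Markov chain `P` from `π` is at most `ε`,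
whatever the starting state. -/
def sepMixedTimes {V : Type u} [Fintype V] [DecidableEq V] (P : Matrix V V ℝ) (π : V → ℝ)
    (ε : ℝ) : Set ℕ :=
  {n | ∀ u v : V, 1 - (P ^ n) u v / π v ≤ ε}

/-- The mixing time `τ_s(ε)` in separation distance. -/
noncomputable def sepMixingTime {V : Type u} [Fintype V] [DecidableEq V] (P : Matrix V V ℝ)
    (π : V → ℝ) (ε : ℝ) : ℕ :=
  sInf (sepMixedTimes P π ε)

/-- The uniform distribution on a finite set. -/
noncomputable def uniformDist (V : Type u) [Fintype V] : V → ℝ := fun _ => 1 / (Fintype.card V : ℝ)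

/-- The part of the Rho Markov chain made of the moves `g ↦ g x` and `g ↦ g y`, each of
probability `1/3`. -/
noncomputable def shiftPart {G : Type u} [Group G] [DecidableEq G] (x y : G) : Matrix G G ℝ :=
  Matrix.of fun g h => (if h = g * x then 1 / 3 else 0) + (if h = g * y then 1 / 3 else 0)

/-- The part of the Rho Markov chain made of the move `g ↦ g ^ 2`, of probability `1/3`. -/
noncomputable def squarePart (G : Type u) [Group G] [DecidableEq G] : Matrix G G ℝ :=
  Matrix.of fun g h => if h = g ^ 2 then 1 / 3 else 0

/-- The block walk: one step is the Rho Markov chain run up to and including its first squaring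
move. The `n`-th term is the probability that exactly `n` moves precede that squaring and that
the block leads from `g` to `h`. -/
noncomputable def blockWalk {G : Type u} [Group G] [Fintype G] [DecidableEq G] (x y : G) :
    Matrix G G ℝ :=
  Matrix.of fun g h => ∑' n : ℕ, (shiftPart x y ^ n * squarePart G) g h

end PollardRho

/-! While the walk meets only new elements, the class of the current one is independent of the past.
The probability of no collision is therefore at most the probability that the Rho Markov chain
visits distinct states (`one_sub_collisionProb_le`). About a third of the moves are squarings, and
by Chebyshev `n` moves contain fewer than about `n / 4` of them with probability at most `32 / (n +
1)`. Otherwise the block walk makes that many steps without repetition (`freshProb_le`), and a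
birthday argument bounds this. The first `w` or so blocks collect `w` distinct states; after that
each stretch of `τ` blocks ends in one of them with probability at least `w / (2|G|)`, wherever it
starts. Surviving `w / τ` stretches has probability at most `exp (-w² / (2|G|τ))`, which is `exp
(-c)` for `w = √(2c|G|τ)`.

It remains to show that `τ` is of order at most `log |G| * log (log |G|)`. The discrete logarithm to
base `x` turns `G` into `ZMod N`. On characters a block doubles the frequency and contributes a
factor of modulus at most `1`, and at most `1 / 2` if the doubled frequency is in the middle half of
`ZMod N`. A frequency `a` is there exactly when the first two binary digits of `a / N` differ, so
the decay is governed by the digit changes of `a / N`. Few frequencies have few changes, which makes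
the Fourier sum small (`sum_prod_weight_le`). -/

namespace PollardRho

/-! ### The block walk is a stochastic matrix. -/

section BlockWalk

variable {G : Type u} [Group G] [Fintype G] [DecidableEq G] (x y : G)

lemma shiftPart_mul_apply (M : Matrix G G ℝ) (g h : G) :
    (shiftPart x y * M) g h = 1 / 3 * (M (g * x) h + M (g * y) h) := by
  simp only [Matrix.mul_apply, shiftPart, Matrix.of_apply, add_mul, ite_mul, zero_mul,
    Finset.sum_add_distrib, Finset.sum_ite_eq', Finset.mem_univ, if_true]
  ring

lemma shiftPart_pow_mul_squarePart_nonneg (n : ℕ) (g h : G) :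
    0 ≤ (shiftPart x y ^ n * squarePart G) g h := by
  induction n generalizing g with
  | zero => simp only [pow_zero, one_mul, squarePart, Matrix.of_apply]; split_ifs <;> norm_num
  | succ n ih =>
    rw [pow_succ', Matrix.mul_assoc, shiftPart_mul_apply]
    have := ih (g * x)
    have := ih (g * y)
    positivity

lemma shiftPart_pow_mul_squarePart_le (n : ℕ) (g h : G) :
    (shiftPart x y ^ n * squarePart G) g h ≤ (2 / 3) ^ n := by
  induction n generalizing g with
  | zero => simp only [pow_zero, one_mul, squarePart, Matrix.of_apply]; split_ifs <;> norm_num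
  | succ n ih =>
    rw [pow_succ', Matrix.mul_assoc, shiftPart_mul_apply, pow_succ]
    linarith [ih (g * x), ih (g * y)]

lemma summable_blockWalk (g h : G) :
    Summable fun n : ℕ => (shiftPart x y ^ n * squarePart G) g h :=
  Summable.of_nonneg_of_le (fun n => shiftPart_pow_mul_squarePart_nonneg x y n g h)
    (fun n => shiftPart_pow_mul_squarePart_le x y n g h)
    (summable_geometric_of_lt_one (by norm_num) (by norm_num))

lemma blockWalk_nonneg (g h : G) : 0 ≤ blockWalk x y g h :=
  tsum_nonneg fun n => shiftPart_pow_mul_squarePart_nonneg x y n g h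

/-- First-step decomposition of the block walk. -/
lemma blockWalk_apply (g h : G) :
    blockWalk x y g h = (if h = g ^ 2 then 1 / 3 else 0) +
      1 / 3 * (blockWalk x y (g * x) h + blockWalk x y (g * y) h) := by
  have key : ∀ g, blockWalk x y g h = ∑' n : ℕ, (shiftPart x y ^ n * squarePart G) g h :=
    fun _ => rfl
  rw [key, (summable_blockWalk x y g h).tsum_eq_zero_add]
  congr 1
  · simp [squarePart]
  · simp only [pow_succ', Matrix.mul_assoc, shiftPart_mul_apply]
    rw [tsum_mul_left, (summable_blockWalk x y _ h).tsum_add (summable_blockWalk x y _ h)]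
    rfl

lemma sum_blockWalk_mul {R : Type*} [RCLike R] (f : G → R) (g : G) :
    ∑ h, (blockWalk x y g h : R) * f h = 1 / 3 * (f (g ^ 2) +
      ∑ h, (blockWalk x y (g * x) h : R) * f h + ∑ h, (blockWalk x y (g * y) h : R) * f h) := by
  have : ∀ h, (blockWalk x y g h : R) * f h = (if h = g ^ 2 then 1 / 3 * f h else 0) +
      1 / 3 * ((blockWalk x y (g * x) h : R) * f h + (blockWalk x y (g * y) h : R) * f h) := by
    intro h
    rw [blockWalk_apply x y g h]
    split_ifs <;> push_cast <;> ring
  rw [Finset.sum_congr rfl fun h _ => this h, Finset.sum_add_distrib, ← Finset.mul_sum,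
    Finset.sum_add_distrib]
  simp only [Finset.sum_ite_eq', Finset.mem_univ, if_true]
  ring

omit [DecidableEq G] in
/-- A function on `G` is determined by the inhomogeneous equation of the shift moves. -/
lemma eq_of_first_step {R : Type*} [RCLike R] {a f f' : G → R}
    (hf : ∀ g, f g = 1 / 3 * (a g + f (g * x) + f (g * y)))
    (hf' : ∀ g, f' g = 1 / 3 * (a g + f' (g * x) + f' (g * y))) : f = f' := by
  -- Maximum principle: the two shift moves have total weight `2 / 3 < 1`, so the largest difference
  -- vanishes.
  obtain ⟨g₁, -, hg₁⟩ := Finset.exists_max_image Finset.univ (fun g => ‖f g - f' g‖)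
    ⟨1, Finset.mem_univ _⟩
  have hmax : ∀ g, ‖f g - f' g‖ ≤ ‖f g₁ - f' g₁‖ := fun g => hg₁ g (Finset.mem_univ g)
  have h1 : f g₁ - f' g₁ =
      1 / 3 * ((f (g₁ * x) - f' (g₁ * x)) + (f (g₁ * y) - f' (g₁ * y))) := by
    rw [hf g₁, hf' g₁]; ring
  have h2 : ‖f g₁ - f' g₁‖ ≤ 1 / 3 * (‖f g₁ - f' g₁‖ + ‖f g₁ - f' g₁‖) := by
    calc ‖f g₁ - f' g₁‖
        = 1 / 3 * ‖(f (g₁ * x) - f' (g₁ * x)) + (f (g₁ * y) - f' (g₁ * y))‖ := by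
          conv_lhs => rw [h1]
          rw [norm_mul]; simp
      _ ≤ _ := by
          gcongr
          exact (norm_add_le _ _).trans (add_le_add (hmax _) (hmax _))
  have h3 : ‖f g₁ - f' g₁‖ ≤ 0 := by linarith
  funext g
  have := (hmax g).trans h3
  exact sub_eq_zero.1 (norm_le_zero_iff.1 this)

lemma sum_blockWalk (g : G) : ∑ h, blockWalk x y g h = 1 := by
  have := eq_of_first_step x y (a := fun _ => (1 : ℝ))
    (f := fun g => ∑ h, blockWalk x y g h * 1) (f' := fun _ => 1)
    (fun g => sum_blockWalk_mul (R := ℝ) x y (fun _ => 1) g) (fun g => by norm_num)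
  simpa using congrFun this g

lemma blockWalk_pow_nonneg (n : ℕ) (g h : G) : 0 ≤ (blockWalk x y ^ n) g h := by
  induction n generalizing g with
  | zero => simp only [pow_zero, Matrix.one_apply]; split_ifs <;> norm_num
  | succ n ih =>
    rw [pow_succ', Matrix.mul_apply]
    exact Finset.sum_nonneg fun k _ => mul_nonneg (blockWalk_nonneg x y g k) (ih k)

lemma sum_blockWalk_pow (n : ℕ) (g : G) : ∑ h, (blockWalk x y ^ n) g h = 1 := by
  induction n generalizing g with
  | zero => simp [Matrix.one_apply]
  | succ n ih =>
    simp only [pow_succ', Matrix.mul_apply]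
    rw [Finset.sum_comm]
    simp only [← Finset.mul_sum, ih, mul_one, sum_blockWalk]

end BlockWalk

/-! ### Lower tail of the number of squarings. -/

section LowerTail

/-- The probability that a binomial variable with parameters `m` and `1 / 3` is below `k`. -/
noncomputable def lowerTail : ℕ → ℕ → ℝ
  | 0, _ => 0
  | _ + 1, 0 => 1
  | k + 1, m + 1 => 2 / 3 * lowerTail (k + 1) m + 1 / 3 * lowerTail k m

lemma lowerTail_nonneg (k m : ℕ) : 0 ≤ lowerTail k m := by
  induction m generalizing k with
  | zero => cases k <;> simp [lowerTail]
  | succ m ih =>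
    cases k with
    | zero => simp [lowerTail]
    | succ k =>
      have := ih k
      have := ih (k + 1)
      simp only [lowerTail]; positivity

/-- Chebyshev's inequality about an arbitrary centre `r`. -/
lemma lowerTail_mul_sq_le (k m : ℕ) (r : ℝ) (hr : (k : ℝ) - 1 ≤ r) :
    lowerTail k m * (r - k + 1) ^ 2 ≤ 2 / 9 * m + (m / 3 - r) ^ 2 := by
  -- The centre must vary: a success replaces `(k, r)` by `(k - 1, r - 1)`, which preserves `r - k +
  -- 1`. The right side is the second moment about `r`.
  induction m generalizing k r with
  | zero =>
    cases k with
    | zero => simp [lowerTail]; positivity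
    | succ k =>
      push_cast at hr ⊢
      simp only [lowerTail]
      have : (0 : ℝ) ≤ k := k.cast_nonneg
      nlinarith
  | succ m ih =>
    cases k with
    | zero => simp only [lowerTail, zero_mul]; positivity
    | succ k =>
      have h1 := ih (k + 1) r hr
      have h2 := ih k (r - 1) (by push_cast at hr; linarith)
      push_cast at h1 h2 ⊢
      simp only [lowerTail]
      ring_nf at h1 h2 ⊢
      linarith

end LowerTail

/-! ### Chains that avoid their past. -/

section Avoidance

variable {G : Type u} [Group G] [Fintype G] [DecidableEq G] (x y : G)

/-- The probability that `k` steps of the block walk from `g` visit distinct states outside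
`A`. -/
noncomputable def avoidProb : ℕ → Finset G → G → ℝ
  | 0, _, _ => 1
  | k + 1, A, g => ∑ h, blockWalk x y g h * (if h ∈ A then 0 else avoidProb k (insert h A) h)

/-- The probability that `m` steps of the Rho Markov chain from `g`, the starting point
included, visit distinct states outside `D`. -/
noncomputable def freshProb : ℕ → Finset G → G → ℝ
  | 0, D, g => if g ∈ D then 0 else 1
  | m + 1, D, g => if g ∈ D then 0 else
      1 / 3 * (freshProb m (insert g D) (g * x) + freshProb m (insert g D) (g ^ 2) +
        freshProb m (insert g D) (g * y))

lemma avoidProb_nonneg (k : ℕ) (A : Finset G) (g : G) : 0 ≤ avoidProb x y k A g := by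
  induction k generalizing A g with
  | zero => simp [avoidProb]
  | succ k ih =>
    refine Finset.sum_nonneg fun h _ => mul_nonneg (blockWalk_nonneg x y g h) ?_
    split_ifs
    exacts [le_rfl, ih _ _]

lemma avoidProb_anti (k : ℕ) {A A' : Finset G} (hA : A ⊆ A') (g : G) :
    avoidProb x y k A' g ≤ avoidProb x y k A g := by
  induction k generalizing A A' g with
  | zero => simp [avoidProb]
  | succ k ih =>
    refine Finset.sum_le_sum fun h _ => mul_le_mul_of_nonneg_left ?_ (blockWalk_nonneg x y g h)
    by_cases h' : h ∈ A'
    · rw [if_pos h']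
      split_ifs
      exacts [le_rfl, avoidProb_nonneg x y _ _ _]
    · rw [if_neg h', if_neg fun hh => h' (hA hh)]
      exact ih (Finset.insert_subset_insert h hA) h

omit [Fintype G] in
lemma freshProb_of_mem (m : ℕ) {D : Finset G} {g : G} (h : g ∈ D) : freshProb x y m D g = 0 := by
  cases m <;> simp [freshProb, h]

omit [Fintype G] in
lemma freshProb_le_one (m : ℕ) (D : Finset G) (g : G) : freshProb x y m D g ≤ 1 := by
  induction m generalizing D g with
  | zero => simp only [freshProb]; split_ifs <;> norm_num
  | succ m ih =>
    simp only [freshProb]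
    split_ifs
    · norm_num
    · linarith [ih (insert g D) (g * x), ih (insert g D) (g ^ 2), ih (insert g D) (g * y)]

lemma avoidProb_succ (k : ℕ) (A : Finset G) (g : G) :
    avoidProb x y (k + 1) A g = 1 / 3 *
      ((if g ^ 2 ∈ A then 0 else avoidProb x y k (insert (g ^ 2) A) (g ^ 2)) +
        avoidProb x y (k + 1) A (g * x) + avoidProb x y (k + 1) A (g * y)) :=
  sum_blockWalk_mul (R := ℝ) x y
    (fun h => if h ∈ A then 0 else avoidProb x y k (insert h A) h) g

/-- Distinct states within `m` steps force either few squarings or a block walk without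
repetition. -/
lemma freshProb_le (k m : ℕ) {A D : Finset G} {g : G} (hA : A ⊆ insert g D) :
    freshProb x y m D g ≤ lowerTail k m + avoidProb x y k A g := by
  induction m generalizing k A D g with
  | zero =>
    cases k with
    | zero => simpa [lowerTail, avoidProb] using freshProb_le_one x y 0 D g
    | succ k =>
      simp only [lowerTail]
      linarith [freshProb_le_one x y 0 D g, avoidProb_nonneg x y (k + 1) A g]
  | succ m ih =>
    cases k with
    | zero => simpa [lowerTail, avoidProb] using freshProb_le_one x y (m + 1) D g
    | succ k =>
      by_cases hg : g ∈ D
      · rw [freshProb_of_mem x y _ hg]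
        exact add_nonneg (lowerTail_nonneg _ _) (avoidProb_nonneg x y _ _ _)
      rw [avoidProb_succ]
      simp only [freshProb, lowerTail, if_neg hg]
      have hx := ih (k + 1) (A := A) (D := insert g D) (g := g * x)
        (hA.trans (Finset.subset_insert _ _))
      have hy := ih (k + 1) (A := A) (D := insert g D) (g := g * y)
        (hA.trans (Finset.subset_insert _ _))
      -- Only a squaring completes a block. All of `A` has been visited, so a squaring that lands in
      -- `A` is a repetition.
      have hs : freshProb x y m (insert g D) (g ^ 2) ≤ lowerTail k m +
          (if g ^ 2 ∈ A then 0 else avoidProb x y k (insert (g ^ 2) A) (g ^ 2)) := by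
        split_ifs with h
        · rw [freshProb_of_mem x y m (hA h)]
          linarith [lowerTail_nonneg k m]
        · exact ih k (Finset.insert_subset_insert _ hA)
      linarith

/-- Each surviving step adds a new element to `A`, so `j` steps enlarge it by `j`; the other
outcomes count `0 ≤ q`. -/
lemma avoidProb_le_of_card (j k : ℕ) (A : Finset G) (g : G) {q : ℝ} (hq : 0 ≤ q)
    (h : ∀ A' : Finset G, A.card + j ≤ A'.card → ∀ g', avoidProb x y k A' g' ≤ q) :
    avoidProb x y (j + k) A g ≤ q := by
  induction j generalizing A g with
  | zero => rw [Nat.zero_add]; exact h A le_rfl g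
  | succ j ih =>
    rw [Nat.add_right_comm, avoidProb]
    calc _ ≤ ∑ h, blockWalk x y g h * q := by
          refine Finset.sum_le_sum fun b _ =>
            mul_le_mul_of_nonneg_left ?_ (blockWalk_nonneg x y g b)
          split_ifs with hb
          · exact hq
          · refine ih _ _ fun A' hA' => h A' ?_
            rw [Finset.card_insert_of_notMem hb] at hA'
            omega
      _ = q := by rw [← Finset.sum_mul, sum_blockWalk, one_mul]

/-- Only the state after `j + 1` steps is tested: dropping the earlier tests and the growth of `A`
can only raise the probability. -/
lemma avoidProb_add_le (j k : ℕ) (A : Finset G) (g : G) :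
    avoidProb x y (j + 1 + k) A g ≤
      ∑ h, (blockWalk x y ^ (j + 1)) g h * (if h ∈ A then 0 else avoidProb x y k A h) := by
  induction j generalizing g with
  | zero =>
    rw [Nat.zero_add, Nat.add_comm, avoidProb, pow_one]
    refine Finset.sum_le_sum fun b _ => mul_le_mul_of_nonneg_left ?_ (blockWalk_nonneg x y g b)
    split_ifs
    exacts [le_rfl, avoidProb_anti x y k (Finset.subset_insert _ _) b]
  | succ j ih =>
    rw [show j + 1 + 1 + k = j + 1 + k + 1 by ring, avoidProb, pow_succ' _ (j + 1)]
    simp only [Matrix.mul_apply, Finset.sum_mul, mul_assoc]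
    rw [Finset.sum_comm]
    simp only [← Finset.mul_sum]
    refine Finset.sum_le_sum fun b _ => mul_le_mul_of_nonneg_left ?_ (blockWalk_nonneg x y g b)
    refine le_trans ?_ (ih b)
    split_ifs
    exacts [avoidProb_nonneg x y _ _ _, avoidProb_anti x y _ (Finset.subset_insert _ _) b]

/-- Testing membership in `A` at every `p`-th step suffices: each test succeeds with probability at
least `A.card * δ`, whatever the previous state. -/
lemma avoidProb_mul_le {p : ℕ} (hp : p ≠ 0) {δ : ℝ}
    (hδ : ∀ g h : G, δ ≤ (blockWalk x y ^ p) g h) (r : ℕ) (A : Finset G) (g : G) :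
    avoidProb x y (r * p) A g ≤ (1 - A.card * δ) ^ r := by
  obtain ⟨j, rfl⟩ := Nat.exists_eq_succ_of_ne_zero hp
  have hA : ∀ g, ∑ h ∈ Finset.univ \ A, (blockWalk x y ^ (j + 1)) g h ≤ 1 - A.card * δ := by
    intro g
    have h1 := Finset.sum_sdiff (f := (blockWalk x y ^ (j + 1)) g) (Finset.subset_univ A)
    rw [sum_blockWalk_pow] at h1
    have h2 : ∑ _h ∈ A, δ ≤ ∑ h ∈ A, (blockWalk x y ^ (j + 1)) g h :=
      Finset.sum_le_sum fun h _ => hδ g h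
    rw [Finset.sum_const, nsmul_eq_mul] at h2
    linarith
  have h0 : 0 ≤ 1 - A.card * δ :=
    (Finset.sum_nonneg fun h _ => blockWalk_pow_nonneg x y _ g h).trans (hA g)
  induction r generalizing g with
  | zero => simp [avoidProb]
  | succ r ih =>
    rw [Nat.succ_mul, Nat.add_comm]
    refine (avoidProb_add_le x y j _ A g).trans ?_
    calc _ ≤ ∑ h, if h ∈ A then 0 else
            (blockWalk x y ^ (j + 1)) g h * (1 - A.card * δ) ^ r := by
          refine Finset.sum_le_sum fun b _ => ?_
          split_ifs
          · simp
          · exact mul_le_mul_of_nonneg_left (ih b) (blockWalk_pow_nonneg x y _ g b)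
      _ = (∑ h ∈ Finset.univ \ A, (blockWalk x y ^ (j + 1)) g h) * (1 - A.card * δ) ^ r := by
          rw [Finset.sum_mul, ← Finset.filter_notMem_eq_sdiff, Finset.sum_filter]
          refine Finset.sum_congr rfl fun b _ => ?_
          split_ifs <;> simp_all
      _ ≤ _ := by
          rw [pow_succ' (1 - _)]
          exact mul_le_mul_of_nonneg_right (hA g) (pow_nonneg h0 r)

end Avoidance

/-! ### From the random partition to the Markov chain. -/

section RandomPartition

variable {G : Type u} [Group G] [DecidableEq G] (x y : G)

/-- The walk of the partition `S` from `g` visits distinct states outside `D` during its first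
`m` steps. -/
def Fresh (S : G → Fin 3) : ℕ → Finset G → G → Prop
  | 0, D, g => g ∉ D
  | m + 1, D, g => g ∉ D ∧ Fresh S m (insert g D) (step x y S g)

omit [DecidableEq G] in
lemma walk_succ (S : G → Fin 3) (g : G) (n : ℕ) :
    walk x y S g (n + 1) = walk x y S (step x y S g) n := rfl

lemma fresh_of_walk_injective (S : G → Fin 3) (m : ℕ) (D : Finset G) (g : G)
    (hD : ∀ i ≤ m, walk x y S g i ∉ D)
    (hinj : ∀ i j, i < j → j ≤ m → walk x y S g i ≠ walk x y S g j) : Fresh x y S m D g := by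
  induction m generalizing D g with
  | zero => exact hD 0 le_rfl
  | succ m ih =>
    refine ⟨hD 0 (Nat.zero_le _), ih _ _ (fun i hi hmem => ?_) fun i j hij hj => ?_⟩
    · rw [← walk_succ] at hmem
      rcases Finset.mem_insert.1 hmem with h | h
      · exact hinj 0 (i + 1) (Nat.succ_pos i) (by omega) h.symm
      · exact hD (i + 1) (by omega) h
    · exact hinj (i + 1) (j + 1) (by omega) (by omega)

variable [Fintype G]

omit [Group G] in
lemma partitionLaw_real_cylinder (D : Finset G) (s : G → Fin 3) :
    (partitionLaw G).real {S | ∀ d ∈ D, S d = s d} = (1 / 3) ^ D.card := by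
  have hset : {S : G → Fin 3 | ∀ d ∈ D, S d = s d} =
      Set.univ.pi fun d => if d ∈ D then {s d} else Set.univ := by
    ext S
    simp only [Set.mem_ofPred_eq, Set.mem_univ_pi]
    refine forall_congr' fun d => ?_
    by_cases h : d ∈ D <;> simp [h]
  have hone : ∀ d, ((PMF.uniformOfFintype (Fin 3)).toMeasure
      (if d ∈ D then {s d} else Set.univ)).toReal = if d ∈ D then 1 / 3 else 1 := by
    intro d
    split_ifs
    · rw [PMF.toMeasure_apply_singleton _ _ (measurableSet_singleton _)]
      simp
    · simp
  rw [hset, partitionLaw, Measure.real, Measure.pi_pi, ENNReal.toReal_prod]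
  simp only [hone]
  rw [Finset.prod_ite_mem, Finset.univ_inter, Finset.prod_const]

/-- Deferred decisions: `s` records the classes revealed on `D`. At a new `g` one splits by its
class; the extra factor `1 / 3` of the revealed class is the weight of that move in `freshProb`. -/
lemma partitionLaw_real_fresh_le (m : ℕ) (D : Finset G) (g : G) (s : G → Fin 3) :
    (partitionLaw G).real {S | (∀ d ∈ D, S d = s d) ∧ Fresh x y S m D g} ≤
      (1 / 3) ^ D.card * freshProb x y m D g := by
  induction m generalizing D g s with
  | zero =>
    by_cases hg : g ∈ D
    · simp [Fresh, freshProb, hg]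
    · simp [Fresh, freshProb, hg, partitionLaw_real_cylinder]
  | succ m ih =>
    by_cases hg : g ∈ D
    · simp [Fresh, freshProb, hg]
    · let move : Fin 3 → G := fun i => match i with
        | 0 => g * x
        | 1 => g ^ 2
        | 2 => g * y
      have hsub : {S | (∀ d ∈ D, S d = s d) ∧ Fresh x y S (m + 1) D g} ⊆
          ⋃ i : Fin 3, {S | (∀ d ∈ insert g D, S d = Function.update s g i d) ∧
            Fresh x y S m (insert g D) (move i)} := by
        rintro S ⟨hS, -, hF⟩
        refine Set.mem_iUnion.2 ⟨S g, fun d hd => ?_, hF⟩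
        rcases Finset.mem_insert.1 hd with rfl | hd
        · simp
        · rw [Function.update_of_ne (ne_of_mem_of_not_mem hd hg), hS d hd]
      refine (measureReal_mono hsub).trans ((measureReal_iUnion_fintype_le _).trans ?_)
      refine (Finset.sum_le_sum fun i _ => ih (insert g D) (move i) _).trans ?_
      rw [Fin.sum_univ_three, Finset.card_insert_of_notMem hg, freshProb, if_neg hg, pow_succ]
      apply le_of_eq
      simp only [move]
      ring

lemma one_sub_collisionProb_le (g₀ : G) (n : ℕ) :
    1 - collisionProb x y g₀ n ≤ freshProb x y n ∅ g₀ := by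
  have h1 : (partitionLaw G).real Set.univ ≤
      (partitionLaw G).real {S | CollisionWithin x y S g₀ n} +
      (partitionLaw G).real {S | (∀ d ∈ (∅ : Finset G), S d = 0) ∧ Fresh x y S n ∅ g₀} := by
    refine (measureReal_mono ?_).trans (measureReal_union_le _ _)
    intro S _
    by_cases h : CollisionWithin x y S g₀ n
    · exact Or.inl h
    · refine Or.inr ⟨by simp, fresh_of_walk_injective x y S n ∅ g₀ (by simp) ?_⟩
      exact fun i j hij hj hw => h ⟨i, j, hij, hj, hw⟩
  have h2 := partitionLaw_real_fresh_le x y n ∅ g₀ fun _ => 0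
  rw [probReal_univ] at h1
  rw [Finset.card_empty, pow_zero, one_mul] at h2
  rw [collisionProb]
  linarith

end RandomPartition
-- Binary digit changes of `a / N`.
section Digits

variable {N : ℕ} [NeZero N]

/-- The residues whose least representative lies in the middle half of `[0, N]`. -/
def Middle (a : ZMod N) : Prop := N ≤ 4 * a.val ∧ 4 * a.val ≤ 3 * N

instance : DecidablePred (Middle (N := N)) := fun a => by unfold Middle; infer_instance

/-- The times `l < L` at which the doubling orbit of `a` is in the middle half. -/
def middleTimes (L : ℕ) (a : ZMod N) : Finset ℕ :=
  (Finset.range L).filter fun l => Middle (2 ^ l * a)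

lemma val_two_mul (a : ZMod N) :
    (2 * a).val = if N ≤ 2 * a.val then 2 * a.val - N else 2 * a.val := by
  rw [two_mul, ZMod.val_add, ← two_mul]
  have := a.val_lt
  split_ifs with h
  · rw [Nat.mod_eq_sub_mod h, Nat.mod_eq_of_lt (by omega)]
  · exact Nat.mod_eq_of_lt (by omega)

/-- The leading binary digit changes under doubling exactly at the middle residues. -/
lemma middle_iff (hN : Odd N) (a : ZMod N) :
    Middle a ↔ ¬(N ≤ 2 * a.val ↔ N ≤ 2 * (2 * a).val) := by
  have := a.val_lt
  rw [val_two_mul, Middle]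
  obtain ⟨k, hk⟩ := hN
  split_ifs with h <;> omega

lemma digit_congr (hN : Odd N) {L : ℕ} {a b : ZMod N}
    (h0 : N ≤ 2 * a.val ↔ N ≤ 2 * b.val) (h : middleTimes L a = middleTimes L b) :
    ∀ l ≤ L, (N ≤ 2 * (2 ^ l * a).val ↔ N ≤ 2 * (2 ^ l * b).val) := by
  intro l hl
  induction l with
  | zero => simpa using h0
  | succ l ih =>
    have hm : Middle (2 ^ l * a) ↔ Middle (2 ^ l * b) := by
      have h1 : l ∈ middleTimes L a ↔ l ∈ middleTimes L b := by rw [h]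
      simpa [middleTimes, show l < L by omega] using h1
    rw [middle_iff hN, middle_iff hN, ← mul_assoc, ← mul_assoc, ← pow_succ'] at hm
    have := ih (by omega)
    tauto

/-- With equal digits, each doubling subtracts the same multiple of `N` from both representatives.
-/
lemma val_sub_val_pow (a b : ZMod N) (L : ℕ)
    (h : ∀ l < L, (N ≤ 2 * (2 ^ l * a).val ↔ N ≤ 2 * (2 ^ l * b).val)) :
    ((2 ^ L * a).val : ℤ) - (2 ^ L * b).val = 2 ^ L * ((a.val : ℤ) - b.val) := by
  induction L with
  | zero => simp
  | succ L ih =>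
    have h1 := ih fun l hl => h l (by omega)
    have h2 := h L (by omega)
    rw [pow_succ', pow_succ', mul_assoc, mul_assoc, mul_assoc, ← h1, val_two_mul, val_two_mul]
    split_ifs <;> first | tauto | omega

/-- The first digit and the places of change determine the digits. Then the difference of the
representatives is multiplied by `2 ^ L ≥ N` yet stays below `N` in absolute value. -/
lemma middleTimes_injective (hN : Odd N) {L : ℕ} (hL : N ≤ 2 ^ L) {a b : ZMod N}
    (h0 : N ≤ 2 * a.val ↔ N ≤ 2 * b.val) (h : middleTimes L a = middleTimes L b) : a = b := by
  have h1 := val_sub_val_pow a b L fun l hl => digit_congr hN h0 h l hl.le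
  have ha := (2 ^ L * a).val_lt
  have hb := (2 ^ L * b).val_lt
  have hL' : (N : ℤ) ≤ 2 ^ L := by exact_mod_cast hL
  apply ZMod.val_injective
  rcases lt_trichotomy (a.val : ℤ) b.val with h2 | h2 | h2
  · nlinarith
  · exact_mod_cast h2
  · nlinarith

/-- Without a change the digits are constant. All zeros give the data of the residue `0`. If all are
ones, `N - a.val ≥ 1` doubles each time and would exceed `N`. -/
lemma middleTimes_nonempty (hN : Odd N) {L : ℕ} (hL : N < 2 ^ L) {a : ZMod N} (ha : a ≠ 0) :
    (middleTimes L a).Nonempty := by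
  rw [Finset.nonempty_iff_ne_empty]
  intro he
  have h0 : middleTimes L (0 : ZMod N) = ∅ := by
    simp [middleTimes, Middle, NeZero.ne N]
  have hNpos := NeZero.pos N
  by_cases hd : N ≤ 2 * a.val
  · have hval : ∀ l ≤ L, N ≤ 2 * (2 ^ l * a).val ∧
        (N : ℤ) - (2 ^ l * a).val = 2 ^ l * ((N : ℤ) - a.val) := by
      intro l hl
      induction l with
      | zero => simpa using hd
      | succ l ih =>
        obtain ⟨h1, h2⟩ := ih (by omega)
        have hm : ¬ Middle (2 ^ l * a) := fun hm => by
          have : l ∈ middleTimes L a := by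
            simp only [middleTimes, Finset.mem_filter, Finset.mem_range]
            exact ⟨by omega, hm⟩
          rw [he] at this
          simp at this
        rw [middle_iff hN, not_not] at hm
        rw [pow_succ', pow_succ', mul_assoc, mul_assoc, ← h2]
        refine ⟨hm.1 h1, ?_⟩
        rw [val_two_mul, if_pos h1]
        omega
    have h1 := (hval L le_rfl).2
    have h2 := a.val_lt
    have hL' : (N : ℤ) < 2 ^ L := by exact_mod_cast hL
    have h3 : (1 : ℤ) ≤ (N : ℤ) - a.val := by omega
    nlinarith [(2 ^ L * a).val.cast_nonneg (α := ℤ)]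
  · refine ha (middleTimes_injective hN hL.le ?_ (he.trans h0.symm))
    simp [hd, NeZero.ne N]

/-- Nonzero residues inject into pairs of a first digit (the factor `2`) and a nonempty set of times
below `L`; the binomial theorem sums over these sets. -/
lemma sum_pow_card_middleTimes_le (hN : Odd N) {L : ℕ} (hL : N < 2 ^ L) {q : ℝ} (hq : 0 ≤ q) :
    ∑ a ∈ (Finset.univ : Finset (ZMod N)).erase 0, q ^ (middleTimes L a).card ≤
      2 * ((1 + q) ^ L - 1) := by
  have hinj : Set.InjOn (fun a : ZMod N => (decide (N ≤ 2 * a.val), middleTimes L a))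
      ((Finset.univ : Finset (ZMod N)).erase 0) := by
    intro a _ b _ hab
    simp only [Prod.mk.injEq, decide_eq_decide] at hab
    exact middleTimes_injective hN hL.le hab.1 hab.2
  have hsub : ((Finset.univ : Finset (ZMod N)).erase 0).image
      (fun a => (decide (N ≤ 2 * a.val), middleTimes L a)) ⊆
      Finset.univ ×ˢ (Finset.range L).powerset.erase ∅ := by
    intro p hp
    obtain ⟨a, ha, rfl⟩ := Finset.mem_image.1 hp
    simp only [Finset.mem_product, Finset.mem_univ, true_and, Finset.mem_erase,
      Finset.mem_powerset]
    exact ⟨(middleTimes_nonempty hN hL (Finset.ne_of_mem_erase ha)).ne_empty,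
      Finset.filter_subset _ _⟩
  calc _ = ∑ p ∈ ((Finset.univ : Finset (ZMod N)).erase 0).image
        (fun a => (decide (N ≤ 2 * a.val), middleTimes L a)), q ^ p.2.card := by
        rw [Finset.sum_image hinj]
    _ ≤ ∑ p ∈ Finset.univ ×ˢ (Finset.range L).powerset.erase ∅, q ^ p.2.card :=
        Finset.sum_le_sum_of_subset_of_nonneg hsub fun p _ _ => pow_nonneg hq _
    _ = 2 * ((1 + q) ^ L - 1) := by
        rw [Finset.sum_product (Finset.univ : Finset Bool)]
        have h1 := Finset.prod_one_add (f := fun _ => q) (Finset.range L)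
        have h2 := Finset.sum_erase_add (Finset.range L).powerset
          (fun t => q ^ t.card) (Finset.empty_mem_powerset _)
        simp only [Finset.prod_const, Finset.card_range] at h1
        simp only [← h1, Finset.card_empty, pow_zero] at h2
        simp only [Finset.sum_const, Finset.card_univ, Fintype.card_bool, nsmul_eq_mul]
        rw [← h2]; push_cast; ring

end Digits

/-! ### Sums of products of weights along doubling orbits. -/

section MiddleProduct

variable {N : ℕ} [NeZero N]

/-- The bound for the Fourier coefficients of a block. -/
noncomputable def weight (a : ZMod N) : ℝ := if Middle a then 1 / 2 else 1

omit [NeZero N] in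
lemma weight_nonneg (a : ZMod N) : 0 ≤ weight a := by
  unfold weight; split_ifs <;> norm_num

omit [NeZero N] in
lemma prod_weight_eq (L : ℕ) (a : ZMod N) :
    ∏ l ∈ Finset.range L, weight (2 ^ l * a) = (1 / 2) ^ (middleTimes L a).card := by
  simp only [weight, middleTimes]
  rw [Finset.prod_ite]
  simp

lemma prod_le_average_pow {m : ℕ} (hm : 0 < m) (z : ℕ → ℝ) (hz : ∀ i, 0 ≤ z i) :
    ∏ i ∈ Finset.range m, z i ≤ (∑ i ∈ Finset.range m, z i ^ m) / m := by
  have hm' : (m : ℝ) ≠ 0 := by positivity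
  have := Real.geom_mean_le_arith_mean_weighted (Finset.range m) (fun _ => (1 / m : ℝ))
    (fun i => z i ^ m) (fun _ _ => by positivity) (by simp [hm'])
    fun i _ => pow_nonneg (hz i) m
  rw [Finset.prod_congr rfl fun i _ => by
    rw [one_div, Real.pow_rpow_inv_natCast (hz i) hm.ne'], ← Finset.mul_sum] at this
  rw [div_eq_inv_mul, ← one_div]
  exact this

lemma prod_range_mul {M : Type*} [CommMonoid M] (f : ℕ → M) (m L : ℕ) :
    ∏ j ∈ Finset.range (m * L), f j =
      ∏ i ∈ Finset.range m, ∏ l ∈ Finset.range L, f (i * L + l) := by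
  induction m with
  | zero => simp
  | succ m ih => rw [Nat.succ_mul, Finset.prod_range_add, ih, Finset.prod_range_succ]

/-- The product is cut into `m` stretches of length `L`, and AM-GM replaces it by the average of
their `m`-th powers. Since doubling permutes the nonzero residues, every stretch gives the same sum,
with `q = (1 / 2) ^ m`. -/
lemma sum_prod_weight_le (hN : Odd N) {L m : ℕ} (hL : N < 2 ^ L) (hm : 0 < m) :
    ∑ a ∈ (Finset.univ : Finset (ZMod N)).erase 0,
      ∏ j ∈ Finset.range (m * L), weight (2 ^ (j + 1) * a) ≤
      2 * ((1 + (1 / 2) ^ m) ^ L - 1) := by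
  have h2 : IsUnit (2 : ZMod N) := by
    have := (ZMod.isUnit_iff_coprime 2 N).2 (Nat.coprime_two_left.2 hN)
    exact_mod_cast this
  set f : ZMod N → ℝ := fun a => ∏ l ∈ Finset.range L, weight (2 ^ l * a) with hf
  have hf0 : ∀ a, 0 ≤ f a := fun a => Finset.prod_nonneg fun l _ => weight_nonneg _
  have hperm : ∀ k : ℕ, ∑ a ∈ (Finset.univ : Finset (ZMod N)).erase 0, f (2 ^ k * a) ^ m =
      ∑ a ∈ (Finset.univ : Finset (ZMod N)).erase 0, f a ^ m := by
    intro k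
    have hu := h2.pow k
    refine Finset.sum_bij' (fun a _ => 2 ^ k * a) (fun a _ => hu.unit⁻¹ * a) ?_ ?_ ?_ ?_ ?_
    · intro a ha
      simpa [hu.mul_right_eq_zero] using ha
    · intro a ha
      simpa using ha
    · intro a _
      simp [← mul_assoc]
    · intro a _
      simp [← mul_assoc]
    · intro a _; rfl
  calc _ ≤ ∑ a ∈ (Finset.univ : Finset (ZMod N)).erase 0,
        (∑ i ∈ Finset.range m, f (2 ^ (i * L + 1) * a) ^ m) / m := by
        refine Finset.sum_le_sum fun a _ => ?_
        rw [prod_range_mul]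
        refine le_trans (le_of_eq ?_) (prod_le_average_pow hm
          (fun i => f (2 ^ (i * L + 1) * a)) fun i => hf0 _)
        refine Finset.prod_congr rfl fun i _ => Finset.prod_congr rfl fun l _ => ?_
        congr 1
        rw [← mul_assoc, ← pow_add]
        congr 2
        ring
    _ = ∑ a ∈ (Finset.univ : Finset (ZMod N)).erase 0, f a ^ m := by
        rw [← Finset.sum_div, Finset.sum_comm]
        simp only [hperm, Finset.sum_const, Finset.card_range, nsmul_eq_mul]
        field_simp
    _ = ∑ a ∈ (Finset.univ : Finset (ZMod N)).erase 0,
          ((1 / 2 : ℝ) ^ m) ^ (middleTimes L a).card := by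
        refine Finset.sum_congr rfl fun a _ => ?_
        rw [hf]
        simp only []
        rw [prod_weight_eq, ← pow_mul, ← pow_mul, mul_comm]
    _ ≤ _ := sum_pow_card_middleTimes_le hN hL (by positivity)

end MiddleProduct

/-! ### Fourier analysis of the block walk. -/

section Fourier

variable {N : ℕ} [NeZero N]

lemma re_stdAddChar (a : ZMod N) :
    (ZMod.stdAddChar a : ℂ).re = Real.cos (2 * Real.pi * a.val / N) := by
  rw [ZMod.stdAddChar_apply, ZMod.toCircle_apply]
  have : (2 * (Real.pi : ℂ) * Complex.I * (a.val : ℂ) / N) =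
      ((2 * Real.pi * a.val / N : ℝ) : ℂ) * Complex.I := by push_cast; ring
  rw [this, Complex.exp_ofReal_mul_I_re]

lemma norm_stdAddChar (a : ZMod N) : ‖(ZMod.stdAddChar a : ℂ)‖ = 1 := by
  rw [ZMod.stdAddChar_apply]; exact Circle.norm_coe _

lemma re_stdAddChar_nonpos {a : ZMod N} (ha : Middle a) : (ZMod.stdAddChar a : ℂ).re ≤ 0 := by
  rw [re_stdAddChar]
  have hN : (0 : ℝ) < N := by exact_mod_cast NeZero.pos N
  have h1 : (N : ℝ) ≤ 4 * a.val := by exact_mod_cast ha.1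
  have h2 : (4 : ℝ) * a.val ≤ 3 * N := by exact_mod_cast ha.2
  have hpi := Real.pi_pos
  apply Real.cos_nonpos_of_pi_div_two_le_of_le
  · rw [le_div_iff₀ hN]; nlinarith
  · rw [div_le_iff₀ hN]; nlinarith

/-- The Fourier coefficient at `a` of the displacement before the squaring of a block. -/
noncomputable def shiftCoeff (κ a : ZMod N) : ℂ :=
  1 / (3 - ZMod.stdAddChar a - ZMod.stdAddChar (a * κ))

/-- The character value coming from `y` is only bounded by `1`, so the estimate is uniform in `y`.
-/
lemma two_sub_re_le_norm_denom (κ a : ZMod N) :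
    2 - (ZMod.stdAddChar a : ℂ).re ≤
      ‖(3 - ZMod.stdAddChar a - ZMod.stdAddChar (a * κ) : ℂ)‖ := by
  refine le_trans ?_ (Complex.re_le_norm _)
  have h := (Complex.re_le_norm _).trans (norm_stdAddChar (a * κ)).le
  simp only [Complex.sub_re]
  have : (3 : ℂ).re = 3 := rfl
  linarith

lemma denom_ne_zero (κ a : ZMod N) :
    (3 - ZMod.stdAddChar a - ZMod.stdAddChar (a * κ) : ℂ) ≠ 0 := by
  have h1 := two_sub_re_le_norm_denom κ a
  have h2 := (Complex.re_le_norm _).trans (norm_stdAddChar a).le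
  rw [← norm_pos_iff]
  linarith

lemma norm_shiftCoeff_le (κ a : ZMod N) : ‖shiftCoeff κ a‖ ≤ weight a := by
  have h1 := two_sub_re_le_norm_denom κ a
  rw [shiftCoeff, norm_div, norm_one, weight]
  split_ifs with h
  · have := re_stdAddChar_nonpos h
    exact one_div_le_one_div_of_le (by norm_num) (by linarith)
  · have h2 := (Complex.re_le_norm _).trans (norm_stdAddChar a).le
    rw [div_le_one (by linarith)]
    linarith

variable {G : Type u} [Group G] [Fintype G] [DecidableEq G]

/-- Both sides solve the same first-step equation; the squaring turns the frequency `a` into `2 *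
a`. -/
lemma sum_blockWalk_mul_stdAddChar (x y : G) (d : G ≃ ZMod N)
    (hd : ∀ g h, d (g * h) = d g + d h) (hx : d x = 1) (a : ZMod N) (g : G) :
    ∑ h, (blockWalk x y g h : ℂ) * ZMod.stdAddChar (a * d h) =
      shiftCoeff (d y) (2 * a) * ZMod.stdAddChar (2 * a * d g) := by
  refine congrFun (eq_of_first_step x y
    (a := fun g => (ZMod.stdAddChar (a * d (g ^ 2)) : ℂ))
    (f := fun g => ∑ h, (blockWalk x y g h : ℂ) * ZMod.stdAddChar (a * d h))
    (f' := fun g => shiftCoeff (d y) (2 * a) * ZMod.stdAddChar (2 * a * d g))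
    (fun g => sum_blockWalk_mul (R := ℂ) x y (fun h => ZMod.stdAddChar (a * d h)) g)
    fun g => ?_) g
  have h1 : a * d (g ^ 2) = 2 * a * d g := by rw [sq, hd]; ring
  have h2 : 2 * a * d (g * x) = 2 * a * d g + 2 * a := by rw [hd, hx]; ring
  have h3 : 2 * a * d (g * y) = 2 * a * d g + 2 * a * d y := by rw [hd]; ring
  simp only [h1, h2, h3, AddChar.map_add_eq_mul, shiftCoeff]
  have := denom_ne_zero (d y) (2 * a)
  field_simp
  ring

lemma sum_blockWalk_pow_mul_stdAddChar (x y : G) (d : G ≃ ZMod N)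
    (hd : ∀ g h, d (g * h) = d g + d h) (hx : d x = 1) (n : ℕ) (a : ZMod N) (g : G) :
    ∑ h, ((blockWalk x y ^ n) g h : ℂ) * ZMod.stdAddChar (a * d h) =
      (∏ j ∈ Finset.range n, shiftCoeff (d y) (2 ^ (j + 1) * a)) *
        ZMod.stdAddChar (2 ^ n * a * d g) := by
  induction n generalizing a with
  | zero => simp [Matrix.one_apply, apply_ite ((↑) : ℝ → ℂ), ite_mul]
  | succ n ih =>
    simp only [pow_succ _ n, Matrix.mul_apply, Complex.ofReal_sum, Complex.ofReal_mul,
      Finset.sum_mul, mul_assoc]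
    rw [Finset.sum_comm]
    simp only [← Finset.mul_sum, sum_blockWalk_mul_stdAddChar x y d hd hx]
    simp only [mul_left_comm _ (shiftCoeff _ _), ← Finset.mul_sum, ih]
    rw [Finset.prod_range_succ']
    simp only [pow_succ, pow_zero, one_mul, mul_assoc]
    ring

/-- Fourier bound for the distance of the block walk to equilibrium. -/
lemma abs_card_mul_blockWalk_pow_sub_one_le (x y : G) (d : G ≃ ZMod N)
    (hd : ∀ g h, d (g * h) = d g + d h) (hx : d x = 1) (n : ℕ) (g h : G) :
    |N * (blockWalk x y ^ n) g h - 1| ≤ ∑ a ∈ (Finset.univ : Finset (ZMod N)).erase 0,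
      ∏ j ∈ Finset.range n, weight (2 ^ (j + 1) * a) := by
  set F : ZMod N → ℂ := fun a =>
    ∑ k, ((blockWalk x y ^ n) g k : ℂ) * ZMod.stdAddChar (a * d k) with hF
  -- Fourier inversion; the frequency `0` contributes the equilibrium term `1`.
  have hinv : ∑ a : ZMod N, ZMod.stdAddChar (-(a * d h)) * F a =
      (N * (blockWalk x y ^ n) g h : ℂ) := by
    simp only [hF, Finset.mul_sum]
    rw [Finset.sum_comm]
    have hk : ∀ k, ∑ a : ZMod N, ZMod.stdAddChar (-(a * d h)) *
        (((blockWalk x y ^ n) g k : ℂ) * ZMod.stdAddChar (a * d k)) =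
        if k = h then ((blockWalk x y ^ n) g k : ℂ) * N else 0 := by
      intro k
      have h1 : ∀ a : ZMod N, ZMod.stdAddChar (-(a * d h)) *
          (((blockWalk x y ^ n) g k : ℂ) * ZMod.stdAddChar (a * d k)) =
          ((blockWalk x y ^ n) g k : ℂ) * ZMod.stdAddChar (a * (d k - d h)) := by
        intro a
        rw [mul_left_comm, ← AddChar.map_add_eq_mul]
        congr 2
        ring
      simp only [h1]
      rw [← Finset.mul_sum, AddChar.sum_mulShift _ (ZMod.isPrimitive_stdAddChar N)]
      simp [sub_eq_zero]
    simp only [hk]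
    simp [mul_comm]
  have hF0 : F 0 = 1 := by
    simp only [hF, zero_mul, AddChar.map_zero_eq_one, mul_one]
    exact_mod_cast sum_blockWalk_pow x y n g
  have hle : ∀ a, ‖ZMod.stdAddChar (-(a * d h)) * F a‖ ≤
      ∏ j ∈ Finset.range n, weight (2 ^ (j + 1) * a) := by
    intro a
    simp only [hF]
    rw [sum_blockWalk_pow_mul_stdAddChar x y d hd hx, norm_mul, norm_mul, norm_stdAddChar,
      norm_stdAddChar, one_mul, mul_one, norm_prod]
    exact Finset.prod_le_prod (fun _ _ => norm_nonneg _) fun _ _ => norm_shiftCoeff_le _ _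
  have hsplit := Finset.sum_erase_add Finset.univ
    (fun a : ZMod N => ZMod.stdAddChar (-(a * d h)) * F a) (Finset.mem_univ 0)
  rw [hinv, hF0, zero_mul, neg_zero, AddChar.map_zero_eq_one, mul_one] at hsplit
  have hnorm : |N * (blockWalk x y ^ n) g h - 1| =
      ‖∑ a ∈ (Finset.univ : Finset (ZMod N)).erase 0,
        ZMod.stdAddChar (-(a * d h)) * F a‖ := by
    rw [eq_sub_of_add_eq hsplit, ← Real.norm_eq_abs, ← Complex.norm_real]
    push_cast
    rfl
  rw [hnorm]
  exact norm_sum_le_of_le _ fun a _ => hle a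

end Fourier

/-! ### The mixing time of the block walk. -/

section Mixing

variable {G : Type u} [Group G] [Fintype G] [DecidableEq G]

lemma mem_sepMixedTimes_iff (P : Matrix G G ℝ) (n : ℕ) :
    n ∈ sepMixedTimes P (uniformDist G) (1 / 2) ↔
      ∀ g h, 1 / (2 * (Fintype.card G : ℝ)) ≤ (P ^ n) g h := by
  have hN : (0 : ℝ) < Fintype.card G := by exact_mod_cast Fintype.card_pos
  refine forall_congr' fun g => forall_congr' fun h => ?_
  simp only [uniformDist]
  rw [div_div_eq_mul_div, div_one, div_le_iff₀ (by positivity)]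
  constructor <;> intro h <;> linarith

omit [DecidableEq G] in
lemma exists_discrete_log {x : G} (hx : ∀ g : G, g ∈ Subgroup.zpowers x) :
    ∃ d : G ≃ ZMod (Fintype.card G), (∀ g h, d (g * h) = d g + d h) ∧ d x = 1 := by
  let e : Multiplicative (ZMod (Fintype.card G)) ≃* G :=
    zmodMulEquivOfGenerator hx Nat.card_eq_fintype_card
  refine ⟨e.symm.toEquiv.trans Multiplicative.toAdd, fun g h => ?_, ?_⟩
  · exact congrArg Multiplicative.toAdd (e.symm.map_mul g h)
  · exact congrArg Multiplicative.toAdd (zmodMulEquivOfGenerator_symm_apply_generator hx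
      Nat.card_eq_fintype_card)

/-- The Fourier sum is at most `2 * (exp (1 / 5) - 1) ≤ 2 * (5 / 4 - 1) = 1 / 2`. -/
lemma mul_mem_sepMixedTimes (hodd : Odd (Fintype.card G)) {x : G}
    (hx : ∀ g : G, g ∈ Subgroup.zpowers x) (y : G) {m L : ℕ} (hm : 0 < m)
    (hL : Fintype.card G < 2 ^ L) (hmL : 5 * L ≤ 2 ^ m) :
    m * L ∈ sepMixedTimes (blockWalk x y) (uniformDist G) (1 / 2) := by
  rw [mem_sepMixedTimes_iff]
  intro g h
  obtain ⟨d, hd, hdx⟩ := exists_discrete_log hx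
  have hN : (0 : ℝ) < Fintype.card G := by exact_mod_cast Fintype.card_pos
  have : NeZero (Fintype.card G) := ⟨Fintype.card_ne_zero⟩
  have h1 := (abs_card_mul_blockWalk_pow_sub_one_le x y d hd hdx (m * L) g h).trans
    (sum_prod_weight_le hodd hL hm)
  have hq : (1 / 2 : ℝ) ^ m * L ≤ 1 / 5 := by
    have : (5 : ℝ) * L ≤ 2 ^ m := by exact_mod_cast hmL
    rw [one_div, inv_pow, inv_mul_le_iff₀ (by positivity)]
    linarith
  have h2 : (1 + (1 / 2 : ℝ) ^ m) ^ L ≤ 5 / 4 := by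
    calc (1 + (1 / 2 : ℝ) ^ m) ^ L ≤ Real.exp ((1 / 2) ^ m) ^ L := by
          gcongr
          rw [add_comm]
          exact Real.add_one_le_exp _
      _ = Real.exp ((1 / 2) ^ m * L) := by rw [← Real.exp_nat_mul, mul_comm]
      _ ≤ Real.exp (1 / 5) := Real.exp_le_exp.2 hq
      _ ≤ 5 / 4 := by
          have := Real.one_sub_le_exp_neg (1 / 5)
          rw [Real.exp_neg] at this
          rw [show (5 / 4 : ℝ) = (1 - 1 / 5)⁻¹ by norm_num]
          exact le_inv_of_le_inv₀ (by norm_num) this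
  have h3 := (abs_le.1 h1).1
  rw [div_le_iff₀ (by positivity)]
  linarith

/-- The zeroth power is the identity matrix, which has zero entries. Positivity is needed to cut the
walk into stretches of this length. -/
lemma sepMixingTime_ne_zero (hcard : 3 ≤ Fintype.card G) (x y : G)
    (hne : (sepMixedTimes (blockWalk x y) (uniformDist G) (1 / 2)).Nonempty) :
    sepMixingTime (blockWalk x y) (uniformDist G) (1 / 2) ≠ 0 := by
  intro h0
  have h := Nat.sInf_mem hne
  rw [← sepMixingTime, h0, mem_sepMixedTimes_iff] at h
  obtain ⟨g, k, hgk⟩ := Fintype.exists_pair_of_one_lt_card (α := G) (by omega)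
  have := h g k
  rw [pow_zero, Matrix.one_apply_ne hgk] at this
  have hN : (0 : ℝ) < Fintype.card G := by exact_mod_cast Fintype.card_pos
  have : (0 : ℝ) < 1 / (2 * (Fintype.card G : ℝ)) := by positivity
  linarith

/-- Numbers of blocks and block lengths of total order `log N * log (log N)`. -/
lemma exists_block_lengths : ∃ A : ℝ, 0 < A ∧ ∀ N : ℕ, 3 ≤ N → ∃ m L : ℕ, 0 < m ∧
    N < 2 ^ L ∧ 5 * L ≤ 2 ^ m ∧ (m : ℝ) * L ≤ A * (Real.log N * Real.log (Real.log N)) := by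
  have hlog3 : 1 < Real.log 3 := by
    rw [Real.lt_log_iff_exp_lt (by norm_num)]
    exact Real.exp_one_lt_d9.trans (by norm_num)
  have hε : 0 < Real.log (Real.log 3) := Real.log_pos hlog3
  -- `L ≤ 3 log N` and `m ≤ 2 (14 + log log N) + 1`; the constant `29` is absorbed using `log log N
  -- ≥ log log 3 > 0`.
  refine ⟨3 * (29 / Real.log (Real.log 3) + 2), by positivity, fun N hN => ?_⟩
  have hlogb : ∀ k : ℕ, 1 ≤ k → ((Nat.log 2 k : ℕ) : ℝ) ≤ 2 * Real.log k := by
    intro k hk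
    have h1 : ((2 : ℕ) : ℝ) ^ Nat.log 2 k ≤ k := by exact_mod_cast Nat.pow_log_le_self 2 (by omega)
    have h2 := Real.log_le_log (by positivity) h1
    rw [Real.log_pow] at h2
    have := Real.log_two_gt_d9
    push_cast at h2
    nlinarith [(Nat.log 2 k).cast_nonneg (α := ℝ)]
  have hNlog : Real.log 3 ≤ Real.log N := Real.log_le_log (by norm_num) (by exact_mod_cast hN)
  have hloglog : Real.log (Real.log 3) ≤ Real.log (Real.log N) :=
    Real.log_le_log (by linarith) hNlog
  have hL : ((Nat.log 2 N + 1 : ℕ) : ℝ) ≤ 3 * Real.log N := by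
    push_cast
    linarith [hlogb N (by omega)]
  have hm : ((Nat.log 2 (5 * (Nat.log 2 N + 1)) + 1 : ℕ) : ℝ) ≤
      (29 / Real.log (Real.log 3) + 2) * Real.log (Real.log N) := by
    have h1 := hlogb (5 * (Nat.log 2 N + 1)) (by omega)
    have h2 : Real.log ((5 * (Nat.log 2 N + 1) : ℕ) : ℝ) ≤ 14 + Real.log (Real.log N) := by
      have h3 : ((5 * (Nat.log 2 N + 1) : ℕ) : ℝ) ≤ 15 * Real.log N := by
        rw [Nat.cast_mul]
        push_cast at hL ⊢
        linarith
      refine (Real.log_le_log (by positivity) h3).trans ?_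
      rw [Real.log_mul (by norm_num) (by linarith)]
      linarith [Real.log_le_sub_one_of_pos (show (0 : ℝ) < 15 by norm_num)]
    have h4 : 29 ≤ 29 / Real.log (Real.log 3) * Real.log (Real.log N) := by
      rw [div_mul_eq_mul_div, le_div_iff₀ hε]
      linarith
    rw [Nat.cast_add, Nat.cast_one]
    linarith
  refine ⟨_, _, Nat.succ_pos (Nat.log 2 (5 * (Nat.log 2 N + 1))),
    Nat.lt_pow_succ_log_self (by norm_num) N,
    (Nat.lt_pow_succ_log_self (by norm_num) _).le, ?_⟩
  calc _ ≤ ((29 / Real.log (Real.log 3) + 2) * Real.log (Real.log N)) * (3 * Real.log N) :=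
        mul_le_mul hm hL (Nat.cast_nonneg _) ((Nat.cast_nonneg _).trans hm)
    _ = _ := by ring

end Mixing

/-! ### The birthday bound and the final estimates. -/

lemma lowerTail_le {K n : ℕ} (h : (K : ℝ) ≤ (n + 1) / 4 - 1) :
    lowerTail K n ≤ 32 / (n + 1) := by
  have hn : (0 : ℝ) ≤ n := n.cast_nonneg
  have h1 := lowerTail_mul_sq_le K n (n / 3) (by linarith)
  -- The gap between the mean `n / 3` and about `n / 4` is about `n / 12`; `(2 / 9) * 12 ^ 2 = 32`
  -- gives the constant.
  have h2 : ((n : ℝ) / 12 + 7 / 4) ^ 2 ≤ ((n : ℝ) / 3 - K + 1) ^ 2 :=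
    pow_le_pow_left₀ (by positivity) (by linarith) 2
  have h3 := mul_le_mul_of_nonneg_left h2 (lowerTail_nonneg K n)
  have h4 : lowerTail K n * ((n : ℝ) / 12 + 7 / 4) ^ 2 ≤ 2 / 9 * n := by
    rw [sub_self, zero_pow two_ne_zero, add_zero] at h1
    exact h3.trans h1
  rw [← le_div_iff₀ (by positivity)] at h4
  refine h4.trans ?_
  rw [div_le_div_iff₀ (by positivity) (by positivity)]
  nlinarith

variable {G : Type u} [Group G] [Fintype G] [DecidableEq G]

/-- The birthday bound for the block walk, transferred to the Rho walk. -/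
lemma one_sub_collisionProb_le_of_mixed (x y g₀ : G) {p : ℕ} (hp : p ≠ 0)
    (hmix : p ∈ sepMixedTimes (blockWalk x y) (uniformDist G) (1 / 2)) {c : ℝ} (hc : 0 < c)
    {n : ℕ}
    (hn : p + 2 * Real.sqrt (2 * c * (Fintype.card G : ℝ) * p) ≤ ((n : ℝ) + 1) / 4 - 1) :
    1 - collisionProb x y g₀ n ≤ 32 / ((n : ℝ) + 1) + Real.exp (-c) := by
  rw [mem_sepMixedTimes_iff] at hmix
  set N : ℝ := (Fintype.card G : ℝ) with hNdef
  have hN : 0 < N := by rw [hNdef]; exact_mod_cast Fintype.card_pos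
  have hp0 : (0 : ℝ) < p := by positivity
  set w := Real.sqrt (2 * c * N * p) with hw
  have hw0 : 0 < w := Real.sqrt_pos.2 (by positivity)
  have hww : w * w = 2 * c * N * p := Real.mul_self_sqrt (by positivity)
  -- The start `g₀` already counts, so `s = ⌈w⌉₊ - 1` blocks collect at least `w` states. Then come
  -- `r` stretches of `p` blocks, at most `2 * w + p` blocks altogether.
  obtain ⟨s, hs⟩ : ∃ s, ⌈w⌉₊ = s + 1 := Nat.exists_eq_add_of_lt (Nat.ceil_pos.2 hw0) |>.imp
    fun s h => by omega
  set r := ⌈w / p⌉₊ with hr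
  have hs1 : w ≤ s + 1 := by
    have := Nat.le_ceil w
    rw [hs] at this
    exact_mod_cast this
  have hs2 : (s : ℝ) ≤ w := by
    have := Nat.ceil_lt_add_one hw0.le
    rw [hs] at this
    push_cast at this
    linarith
  have hr1 : w / p ≤ r := Nat.le_ceil _
  have hr2 : (r : ℝ) * p ≤ w + p := by
    have := (Nat.ceil_lt_add_one (div_pos hw0 hp0).le).le
    calc (r : ℝ) * p ≤ (w / p + 1) * p := by gcongr
      _ = w + p := by field_simp
  have hK : ((s + r * p : ℕ) : ℝ) ≤ ((n : ℝ) + 1) / 4 - 1 := by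
    push_cast
    linarith
  have hfresh := freshProb_le x y (s + r * p) n (A := {g₀}) (D := ∅) (g := g₀) (by simp)
  have havoid : avoidProb x y (s + r * p) {g₀} g₀ ≤ Real.exp (-c) := by
    refine avoidProb_le_of_card x y s (r * p) {g₀} g₀ (Real.exp_pos _).le fun A hA g => ?_
    refine (avoidProb_mul_le x y hp hmix r A g).trans ?_
    have hA1 : (s : ℝ) + 1 ≤ A.card := by
      rw [Finset.card_singleton] at hA
      have : s + 1 ≤ A.card := by omega
      exact_mod_cast this
    have hA2 : (A.card : ℝ) ≤ N := by rw [hNdef]; exact_mod_cast A.card_le_univ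
    have h0 : 0 ≤ 1 - (A.card : ℝ) * (1 / (2 * N)) := by
      rw [mul_one_div, sub_nonneg, div_le_one (by positivity)]
      linarith
    refine (pow_le_pow_left₀ h0 (Real.one_sub_le_exp_neg _) r).trans ?_
    rw [← Real.exp_nat_mul, Real.exp_le_exp]
    have h1 : w / p * w ≤ r * A.card :=
      mul_le_mul hr1 (hs1.trans hA1) hw0.le (Nat.cast_nonneg _)
    have h2 : w / p * w = 2 * c * N := by
      rw [div_mul_eq_mul_div, hww]
      field_simp
    have h3 : (r : ℝ) * (A.card * (1 / (2 * N))) = r * A.card / (2 * N) := by ring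
    rw [mul_neg, h3, neg_le_neg_iff, le_div_iff₀ (by positivity)]
    linarith
  linarith [one_sub_collisionProb_le x y g₀ n, lowerTail_le hK]

lemma log_mul_log_log_le {N : ℝ} (hN : 1 < N) (hlog : 1 ≤ Real.log N) :
    Real.log N * Real.log (Real.log N) ≤ 4 * N := by
  have h1 : Real.log N ≤ 2 * Real.sqrt N := by
    have h2 := Real.log_le_sub_one_of_pos (Real.sqrt_pos.2 (by linarith : 0 < N))
    rw [Real.log_sqrt (by linarith)] at h2
    linarith
  have h3 := Real.log_le_sub_one_of_pos (by linarith : 0 < Real.log N)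
  have h4 := Real.mul_self_sqrt (by linarith : 0 ≤ N)
  calc Real.log N * Real.log (Real.log N) ≤ Real.log N * Real.log N :=
        mul_le_mul_of_nonneg_left (by linarith) (by linarith)
    _ ≤ (2 * Real.sqrt N) * (2 * Real.sqrt N) := by gcongr
    _ = 4 * N := by linarith

/-- Here `Λ` stands for `log N * log (log N)`. Since `Λ ≤ 4 * N`, the linear term in `τ` is also of
order `√(N * Λ)`. -/
lemma add_sqrt_le {A c N Λ τ : ℝ} (hA : 0 < A) (hc : 0 < c) (hN : 0 < N) (hΛ : 0 ≤ Λ)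
    (hΛN : Λ ≤ 4 * N) (hτ : τ ≤ A * Λ) :
    τ + 2 * Real.sqrt (2 * c * N * τ) ≤
      (2 * A + 2 * Real.sqrt (2 * A)) * Real.sqrt ((1 + c) * (N * Λ)) := by
  have h1 : Λ ≤ 2 * Real.sqrt ((1 + c) * (N * Λ)) := by
    have h2 : Real.sqrt (Λ ^ 2) ≤ Real.sqrt (2 ^ 2 * ((1 + c) * (N * Λ))) := by
      apply Real.sqrt_le_sqrt
      have : 0 ≤ c * (N * Λ) := by positivity
      nlinarith
    rwa [Real.sqrt_sq hΛ, Real.sqrt_mul (by positivity), Real.sqrt_sq (by norm_num)] at h2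
  have h3 : Real.sqrt (2 * c * N * τ) ≤
      Real.sqrt (2 * A) * Real.sqrt ((1 + c) * (N * Λ)) := by
    rw [← Real.sqrt_mul (by positivity)]
    apply Real.sqrt_le_sqrt
    calc 2 * c * N * τ ≤ 2 * c * N * (A * Λ) := by gcongr
      _ = 2 * A * (c * (N * Λ)) := by ring
      _ ≤ 2 * A * ((1 + c) * (N * Λ)) := by gcongr; linarith
  nlinarith

end PollardRho

theorem mainTheorem5 :
    ∃ C : ℝ, 0 < C ∧
      ∀ (G : Type u) [Group G] [Fintype G] [DecidableEq G],
        Odd (Fintype.card G) → 3 ≤ Fintype.card G →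
        ∀ x : G, (∀ g : G, g ∈ Subgroup.zpowers x) → ∀ y g₀ : G,
          -- the mixing time of the block walk is finite
          (PollardRho.sepMixedTimes (PollardRho.blockWalk x y)
              (PollardRho.uniformDist G) (1 / 2)).Nonempty ∧
          -- the collision bound in terms of that mixing time
          (∀ c τ t : ℝ, 0 < c →
            τ = (PollardRho.sepMixingTime (PollardRho.blockWalk x y)
              (PollardRho.uniformDist G) (1 / 2) : ℝ) →
            t = 4 * (1 + τ + 2 * Real.sqrt (2 * c * (Fintype.card G : ℝ) * τ)) →
            1 - Real.exp (-c) - 32 / t ≤ PollardRho.collisionProb x y g₀ ⌊t⌋₊) ∧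
          -- the bound of order `√(|G| log |G| log log |G|)`
          (∀ c : ℝ, 0 < c → ∀ n : ℕ,
            C * Real.sqrt ((1 + c) * ((Fintype.card G : ℝ) * Real.log (Fintype.card G : ℝ) *
              Real.log (Real.log (Fintype.card G : ℝ)))) ≤ (n : ℝ) →
            1 - Real.exp (-c) - 32 / (n : ℝ) ≤ PollardRho.collisionProb x y g₀ n) := by
  obtain ⟨A, hA, hblocks⟩ := PollardRho.exists_block_lengths
  refine ⟨8 * (2 * A + 2 * Real.sqrt (2 * A)), by positivity, ?_⟩
  intro G _ _ _ hodd hcard x hx y g₀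
  obtain ⟨m, L, hm, hL, hmL, hbound⟩ := hblocks _ hcard
  have hmem := PollardRho.mul_mem_sepMixedTimes hodd hx y hm hL hmL
  have hne : (PollardRho.sepMixedTimes (PollardRho.blockWalk x y)
      (PollardRho.uniformDist G) (1 / 2)).Nonempty := ⟨_, hmem⟩
  have hp := PollardRho.sepMixingTime_ne_zero hcard x y hne
  have hmix : PollardRho.sepMixingTime (PollardRho.blockWalk x y) (PollardRho.uniformDist G)
      (1 / 2) ∈ _ := Nat.sInf_mem hne
  have hple : PollardRho.sepMixingTime (PollardRho.blockWalk x y) (PollardRho.uniformDist G)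
      (1 / 2) ≤ m * L := Nat.sInf_le hmem
  generalize PollardRho.sepMixingTime (PollardRho.blockWalk x y) (PollardRho.uniformDist G)
    (1 / 2) = p at hp hmix hple
  have hp1 : (1 : ℝ) ≤ p := by exact_mod_cast Nat.one_le_iff_ne_zero.2 hp
  refine ⟨hne, ?_, ?_⟩
  · rintro c τ t hc rfl ht
    have hsqrt := Real.sqrt_nonneg (2 * c * (Fintype.card G : ℝ) * p)
    -- The bound uses `n + 1`, not `n`, so rounding `t` down costs nothing.
    have hfloor := (Nat.lt_floor_add_one t).le
    have hmain := PollardRho.one_sub_collisionProb_le_of_mixed x y g₀ hp hmix hc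
      (n := ⌊t⌋₊) (by linarith)
    have : 32 / ((⌊t⌋₊ : ℝ) + 1) ≤ 32 / t :=
      div_le_div_of_nonneg_left (by norm_num) (by linarith) hfloor
    linarith
  · intro c hc n hn
    have hN : (3 : ℝ) ≤ Fintype.card G := by exact_mod_cast hcard
    have hlog : 1 ≤ Real.log (Fintype.card G : ℝ) := by
      rw [Real.le_log_iff_exp_le (by linarith)]
      linarith [Real.exp_one_lt_d9]
    have hΛ : 0 ≤ Real.log (Fintype.card G : ℝ) * Real.log (Real.log (Fintype.card G : ℝ)) :=
      mul_nonneg (by linarith) (Real.log_nonneg hlog)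
    have hτ : (p : ℝ) ≤ A * (Real.log (Fintype.card G : ℝ) *
        Real.log (Real.log (Fintype.card G : ℝ))) :=
      le_trans (by exact_mod_cast hple) hbound
    have hadd := PollardRho.add_sqrt_le hA hc (by linarith) hΛ
      (PollardRho.log_mul_log_log_le (by linarith) hlog) hτ
    rw [mul_assoc (Fintype.card G : ℝ), mul_assoc (8 : ℝ)] at hn
    have hsqrt := Real.sqrt_nonneg (2 * c * (Fintype.card G : ℝ) * p)
    -- The factor `8` in `C` gives `p + 2w ≤ n / 8`, where `w` is the square root in `hsqrt`. As `p
    -- ≥ 1` this forces `n ≥ 8`, hence `n / 8 ≤ (n + 1) / 4 - 1`.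
    have hmain := PollardRho.one_sub_collisionProb_le_of_mixed x y g₀ hp hmix hc
      (n := n) (by linarith)
    have : 32 / ((n : ℝ) + 1) ≤ 32 / n :=
      div_le_div_of_nonneg_left (by norm_num) (by linarith) (by linarith)
    linarith
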